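/- Let $\mathfrak X$ be a real or complex Banach space and let $\{U_A(t)\}_{t\ge 0}$, $\{U_B(t)\}_{t\ge 0}$, $\{U_C(t)\}_{t\ge 0}$ be strongly continuous semigroups of linear contractions on $\mathfrak X$ with generators $A$, $B$, $C$, in the sign convention $U_A(t)=e^{-tA}$, i.e. $Au=\lim_{t\to 0+}\frac1t\,(u-U_A(t)u)$, where $\operatorname{dom}A$ is the set of all $u$ for which this limit exists in norm (and likewise for $B$ and $C$). Let $D\subset\operatorname{dom}C$ be a core of $C$ (a linear subspace such that $C$ is the closure of its restriction to $D$) with $D\subset\operatorname{dom}A\cap\operatorname{dom}B$ and $$Cu=Au+Bu\qquad\text{for all }u\in D.$$ Then the algebraic sum $A+B$, with domain $\operatorname{dom}A\cap\operatorname{dom}B$, is closable, $C=\overline{A+B}$ is its closure, and for all $t\ge 0$ and all $x\in\mathfrak X$ $$e^{-tC}x=\lim_{n\to\infty}\bigl(e^{-tA/n}\,e^{-tB/n}\bigr)^n x$$ in the norm of $\mathfrak X$. -/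

import Mathlib

open Filter Topology
open scoped NNReal

/-- A strongly continuous one-parameter semigroup `(U(t))_{t ≥ 0}` of linear contractions on a
normed space `X`. -/
structure ContractionSemigroup (𝕜 X : Type*) [RCLike 𝕜] [NormedAddCommGroup X]
    [NormedSpace 𝕜 X] where
  /-- The operator `U(t)`. -/
  toFun : ℝ≥0 → X →L[𝕜] X
  map_zero : toFun 0 = 1
  map_add : ∀ s t : ℝ≥0, toFun (s + t) = toFun s * toFun t
  norm_le_one : ∀ t : ℝ≥0, ‖toFun t‖ ≤ 1
  continuous_apply : ∀ x : X, Continuous fun t : ℝ≥0 => toFun t x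

namespace ContractionSemigroup

variable {𝕜 X : Type*} [RCLike 𝕜] [NormedAddCommGroup X] [NormedSpace 𝕜 X]

instance : CoeFun (ContractionSemigroup 𝕜 X) (fun _ => ℝ≥0 → X →L[𝕜] X) := ⟨toFun⟩

/-- `y` is the limit of `(x - U(t) x) / t` as `t → 0+`. -/
def HasGeneratorAt (U : ContractionSemigroup 𝕜 X) (x y : X) : Prop :=
  Tendsto (fun t : ℝ≥0 => (((t : ℝ) : 𝕜)⁻¹) • (x - U t x)) (𝓝[>] 0) (𝓝 y)

theorem HasGeneratorAt.unique {U : ContractionSemigroup 𝕜 X} {x y z : X}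
    (hy : U.HasGeneratorAt x y) (hz : U.HasGeneratorAt x z) : y = z :=
  tendsto_nhds_unique hy hz

theorem HasGeneratorAt.add {U : ContractionSemigroup 𝕜 X} {x y x' y' : X}
    (h : U.HasGeneratorAt x y) (h' : U.HasGeneratorAt x' y') :
    U.HasGeneratorAt (x + x') (y + y') := by
  refine (Tendsto.add h h').congr fun t => ?_
  rw [← smul_add, _root_.map_add]
  congr 1
  abel

theorem HasGeneratorAt.smul {U : ContractionSemigroup 𝕜 X} {x y : X} (c : 𝕜)
    (h : U.HasGeneratorAt x y) : U.HasGeneratorAt (c • x) (c • y) := by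
  refine (Tendsto.const_smul h c).congr fun t => ?_
  rw [smul_comm, smul_sub, map_smul]

theorem hasGeneratorAt_zero (U : ContractionSemigroup 𝕜 X) : U.HasGeneratorAt 0 0 := by
  simp [HasGeneratorAt]

/-- The generator `A` of the semigroup `U(t) = e^{-tA}`, in the sign convention
`A x = lim_{t → 0+} (x - U(t) x) / t`, with domain the set of all `x` for which the limit exists
in norm. -/
noncomputable def generator (U : ContractionSemigroup 𝕜 X) : X →ₗ.[𝕜] X where
  domain :=
    { carrier := {x | ∃ y, U.HasGeneratorAt x y}
      add_mem' := fun ⟨_, h⟩ ⟨_, h'⟩ => ⟨_, h.add h'⟩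
      zero_mem' := ⟨0, U.hasGeneratorAt_zero⟩
      smul_mem' := fun c _ ⟨_, h⟩ => ⟨_, h.smul c⟩ }
  toFun :=
    { toFun := fun x => x.2.choose
      map_add' := fun x x' =>
        (x + x').2.choose_spec.unique (x.2.choose_spec.add x'.2.choose_spec)
      map_smul' := fun c x => (c • x).2.choose_spec.unique (x.2.choose_spec.smul c) }

theorem mem_generator_domain {U : ContractionSemigroup 𝕜 X} {x : X} :
    x ∈ U.generator.domain ↔ ∃ y, U.HasGeneratorAt x y := Iff.rfl

theorem hasGeneratorAt_generator (U : ContractionSemigroup 𝕜 X) (x : U.generator.domain) :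
    U.HasGeneratorAt x (U.generator x) := x.2.choose_spec

end ContractionSemigroup

/-! ### Iterates of one contraction -/

section Contraction

variable {𝕜 X : Type*} [RCLike 𝕜] [NormedAddCommGroup X] [NormedSpace 𝕜 X]

/-! Everything rests on one elementary estimate, `norm_pow_apply_sub_le`: if `u - T u` is nearly `(u
- v) / k` and nearly the same at `v`, then `T ^ k` carries `u` close to `v`. No resolvents are
needed. For contractions `F h`, the estimate passes to limits of steps and to the closure of the
graph `derivGraph F`.

Chernoff's formula follows by cutting `[0, t]` into `N` blocks and taking as `u`, `v` consecutive
points of the orbit of `S`: each block costs `o(t / N)`, so the total error vanishes as `N → ∞`.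
Taking for `v` a point on a tangent line instead shows that the closure of `derivGraph F` is no
larger than the generator of `S`.

Lie–Trotter is the case `F h = e^{-hA} e^{-hB}`, whose `derivGraph` contains the graph of `A + B`.
The core puts `C` inside the closure of that graph, and the reverse inclusion puts `A + B` inside
`C`. -/

theorem ContinuousLinearMap.norm_apply_le_of_norm_le_one {T : X →L[𝕜] X} (hT : ‖T‖ ≤ 1) (x : X) :
    ‖T x‖ ≤ ‖x‖ := by
  simpa using T.le_of_opNorm_le hT x

theorem ContinuousLinearMap.norm_pow_apply_le_of_norm_le_one {T : X →L[𝕜] X} (hT : ‖T‖ ≤ 1)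
    (k : ℕ) (x : X) : ‖(T ^ k) x‖ ≤ ‖x‖ := by
  induction k with
  | zero => simp
  | succ k ih =>
    rw [pow_succ']
    exact (norm_apply_le_of_norm_le_one hT _).trans ih

/-- The iterates of a contraction follow the linear interpolation between two points. -/
theorem ContinuousLinearMap.norm_pow_apply_sub_le {T : X →L[𝕜] X} (hT : ‖T‖ ≤ 1) (k : ℕ)
    (u v : X) :
    ‖(T ^ k) u - v‖ ≤
      ‖v - u + (k : 𝕜) • (u - T u)‖ + k * ‖(v - T v) - (u - T u)‖ := by
  rcases Nat.eq_zero_or_pos k with rfl | hk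
  · simp [norm_sub_rev]
  have hk' : (k : 𝕜) ≠ 0 := by exact_mod_cast hk.ne'
  have hkr : (0 : ℝ) < k := by exact_mod_cast hk
  set b := ‖v - u + (k : 𝕜) • (u - T u)‖ + k * ‖(v - T v) - (u - T u)‖ with hb
  -- Each step adds at most `b / k` to the distance from the interpolating point, since `T` does not
  -- expand the error already made.
  have key : ∀ j : ℕ, j ≤ k →
      ‖(T ^ j) u - (u + ((j : 𝕜) / k) • (v - u))‖ ≤ (j / k : ℝ) * b := by
    intro j
    induction j with
    | zero => simp
    | succ j ih =>
      intro hj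
      have hjk : (j : ℝ) / k ≤ 1 := by
        rw [div_le_one hkr]; exact_mod_cast (Nat.le_of_succ_le hj)
      have hsplit : (T ^ (j + 1)) u - (u + (((j + 1 : ℕ) : 𝕜) / k) • (v - u)) =
          T ((T ^ j) u - (u + ((j : 𝕜) / k) • (v - u))) -
            ((k : 𝕜)⁻¹ • (v - u + (k : 𝕜) • (u - T u)) +
              ((j : 𝕜) / k) • ((v - T v) - (u - T u))) := by
        have h1 : (T ^ (j + 1)) u = T ((T ^ j) u) := by rw [pow_succ']; rfl
        rw [h1]
        simp only [map_sub, map_add, map_smul, Nat.cast_add, Nat.cast_one, smul_add, smul_smul,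
          inv_mul_cancel₀ hk', one_smul, add_div, one_div, add_smul, smul_sub]
        abel
      have hn1 : ‖(k : 𝕜)⁻¹ • (v - u + (k : 𝕜) • (u - T u))‖
          = (k : ℝ)⁻¹ * ‖v - u + (k : 𝕜) • (u - T u)‖ := by
        rw [norm_smul, norm_inv, RCLike.norm_natCast]
      have hn2 : ‖((j : 𝕜) / k) • ((v - T v) - (u - T u))‖ ≤ ‖(v - T v) - (u - T u)‖ := by
        rw [norm_smul, norm_div, RCLike.norm_natCast, RCLike.norm_natCast]
        exact mul_le_of_le_one_left (norm_nonneg _) hjk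
      have hkb : (k : ℝ)⁻¹ * b = (k : ℝ)⁻¹ * ‖v - u + (k : 𝕜) • (u - T u)‖ +
          ‖(v - T v) - (u - T u)‖ := by
        rw [hb, mul_add, inv_mul_cancel_left₀ hkr.ne']
      calc _ ≤ ‖T ((T ^ j) u - (u + ((j : 𝕜) / k) • (v - u)))‖ + _ := by
            rw [hsplit]; exact norm_sub_le _ _
        _ ≤ (j / k : ℝ) * b + (k : ℝ)⁻¹ * b := by
            refine add_le_add ((norm_apply_le_of_norm_le_one hT _).trans
              (ih (Nat.le_of_succ_le hj))) ?_
            rw [hkb]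
            exact (norm_add_le _ _).trans (add_le_add hn1.le hn2)
        _ = _ := by push_cast; ring
  have := key k le_rfl
  rw [div_self hk', div_self hkr.ne', one_smul, one_mul] at this
  simpa using this

end Contraction

/-! ### Right derivatives at zero and many small steps -/

section DerivGraph

variable {𝕜 X : Type*} [RCLike 𝕜] [NormedAddCommGroup X] [NormedSpace 𝕜 X]

/-- The graph of minus the strong right derivative at `0` of a family of operators `F` (with
`F 0 = 1` in mind): the pairs `(u, y)` such that `(u - F h u) / h → y` as `h → 0+`. -/
def derivGraph (F : ℝ≥0 → X →L[𝕜] X) : Submodule 𝕜 (X × X) where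
  carrier := {p | Tendsto (fun h : ℝ≥0 => (((h : ℝ) : 𝕜)⁻¹) • (p.1 - F h p.1)) (𝓝[>] 0) (𝓝 p.2)}
  add_mem' {p q} hp hq := by
    refine (Tendsto.add hp hq).congr fun h => ?_
    rw [← smul_add, Prod.fst_add, map_add]
    congr 1
    abel
  zero_mem' := by simp
  smul_mem' c p hp := by
    refine (Tendsto.const_smul hp c).congr fun h => ?_
    rw [smul_comm, smul_sub, Prod.smul_fst, map_smul]

theorem mem_derivGraph {F : ℝ≥0 → X →L[𝕜] X} {p : X × X} :
    p ∈ derivGraph F ↔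
      Tendsto (fun h : ℝ≥0 => (((h : ℝ) : 𝕜)⁻¹) • (p.1 - F h p.1)) (𝓝[>] 0) (𝓝 p.2) :=
  Iff.rfl

theorem tendsto_natCast_smul_of_mem_derivGraph {ι : Type*} {l : Filter ι} {F : ℝ≥0 → X →L[𝕜] X}
    {h : ι → ℝ≥0} {k : ι → ℕ} {δ : ℝ} (hh : Tendsto h l (𝓝[>] 0))
    (hk : Tendsto (fun n => (k n : ℝ) * h n) l (𝓝 δ)) {p : X × X} (hp : p ∈ derivGraph F) :
    Tendsto (fun n => (k n : 𝕜) • (p.1 - F (h n) p.1)) l (𝓝 ((δ : 𝕜) • p.2)) := by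
  have h1 : Tendsto (fun n => (((k n : ℝ) * h n : ℝ) : 𝕜)) l (𝓝 (δ : 𝕜)) :=
    (RCLike.continuous_ofReal.tendsto δ).comp hk
  refine (h1.smul ((mem_derivGraph.1 hp).comp hh)).congr' ?_
  filter_upwards [hh self_mem_nhdsWithin] with n hn
  have hn0 : ((h n : ℝ) : 𝕜) ≠ 0 := by
    have : (0 : ℝ≥0) < h n := hn
    exact_mod_cast this.ne'
  simp only [Function.comp_apply, smul_smul]
  congr 1
  push_cast
  rw [mul_assoc, mul_inv_cancel₀ hn0, mul_one]

theorem eventually_norm_pow_apply_sub_lt_of_mem {ι : Type*} {l : Filter ι} {F : ℝ≥0 → X →L[𝕜] X}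
    (hF : ∀ h, ‖F h‖ ≤ 1) {h : ι → ℝ≥0} {k : ι → ℕ} {δ : ℝ} (hh : Tendsto h l (𝓝[>] 0))
    (hk : Tendsto (fun n => (k n : ℝ) * h n) l (𝓝 δ)) {p q : X × X}
    (hp : p ∈ derivGraph F) (hq : q ∈ derivGraph F) {c : ℝ}
    (hc : ‖q.1 - p.1 + (δ : 𝕜) • p.2‖ + ‖(δ : 𝕜) • (q.2 - p.2)‖ < c) :
    ∀ᶠ n in l, ‖(F (h n) ^ k n) p.1 - q.1‖ < c := by
  have h1 := tendsto_natCast_smul_of_mem_derivGraph hh hk hp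
  have h2 := tendsto_natCast_smul_of_mem_derivGraph hh hk (sub_mem hq hp)
  have h3 := (((tendsto_const_nhds (x := q.1 - p.1)).add h1).norm).add h2.norm
  filter_upwards [h3.eventually_lt_const hc] with n hn
  refine lt_of_le_of_lt ?_ hn
  refine (ContinuousLinearMap.norm_pow_apply_sub_le (hF _) _ _ _).trans_eq ?_
  congr 1
  rw [norm_smul, RCLike.norm_natCast]
  congr 2
  simp only [Prod.fst_sub, map_sub]
  abel

/-- All powers of `F h` are contractions, so replacing `p` and `q` by nearby elements of `derivGraph
F` costs an amount independent of the number of steps. -/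
theorem eventually_norm_pow_apply_sub_lt {ι : Type*} {l : Filter ι} {F : ℝ≥0 → X →L[𝕜] X}
    (hF : ∀ h, ‖F h‖ ≤ 1) {h : ι → ℝ≥0} {k : ι → ℕ} {δ : ℝ} (hh : Tendsto h l (𝓝[>] 0))
    (hk : Tendsto (fun n => (k n : ℝ) * h n) l (𝓝 δ)) {p q : X × X}
    (hp : p ∈ (derivGraph F).topologicalClosure) (hq : q ∈ (derivGraph F).topologicalClosure)
    {c : ℝ} (hc : ‖q.1 - p.1 + (δ : 𝕜) • p.2‖ + ‖(δ : 𝕜) • (q.2 - p.2)‖ < c) :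
    ∀ᶠ n in l, ‖(F (h n) ^ k n) p.1 - q.1‖ < c := by
  have hpq : (p, q) ∈ closure ((derivGraph F : Set (X × X)) ×ˢ (derivGraph F : Set (X × X))) := by
    rw [closure_prod_eq]
    exact ⟨hp, hq⟩
  -- The bound for the approximants plus the cost of replacing `p` and `q` by them.
  let φ : (X × X) × (X × X) → ℝ := fun r =>
    ‖r.2.1 - r.1.1 + (δ : 𝕜) • r.1.2‖ + ‖(δ : 𝕜) • (r.2.2 - r.1.2)‖ +
      (‖p.1 - r.1.1‖ + ‖r.2.1 - q.1‖)
  have hφ : Continuous φ := by fun_prop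
  have hφc : φ (p, q) < c := by simpa [φ] using hc
  obtain ⟨⟨p', q'⟩, ⟨hp', hq'⟩, hr⟩ := ((mem_closure_iff_frequently.1 hpq).and_eventually
    (hφ.continuousAt.eventually_lt_const hφc)).exists
  simp only [φ] at hr
  filter_upwards [eventually_norm_pow_apply_sub_lt_of_mem hF hh hk hp' hq'
    (lt_sub_iff_add_lt.2 hr)] with n hn
  have hsplit : (F (h n) ^ k n) p.1 - q.1 =
      (F (h n) ^ k n) (p.1 - p'.1) + ((F (h n) ^ k n) p'.1 - q'.1) + (q'.1 - q.1) := by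
    rw [map_sub]; abel
  rw [hsplit]
  have h1 := norm_add₃_le (a := (F (h n) ^ k n) (p.1 - p'.1))
    (b := (F (h n) ^ k n) p'.1 - q'.1) (c := q'.1 - q.1)
  have h2 := ContinuousLinearMap.norm_pow_apply_le_of_norm_le_one (hF (h n)) (k n) (p.1 - p'.1)
  linarith

end DerivGraph

theorem NNReal.tendsto_div_natCast_nhdsGT_zero {t : ℝ≥0} (ht : 0 < t) :
    Tendsto (fun n : ℕ => t / n) atTop (𝓝[>] 0) := by
  refine tendsto_nhdsWithin_iff.2 ⟨?_, ?_⟩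
  · rw [← NNReal.tendsto_coe]
    simpa using tendsto_const_div_atTop_nhds_zero_nat (t : ℝ)
  · filter_upwards [eventually_gt_atTop 0] with n hn
    exact div_pos ht (by exact_mod_cast hn)

theorem tendsto_natFloor_mul_mul_div {a : ℝ} (ha : 0 ≤ a) (t : ℝ) :
    Tendsto (fun n : ℕ => (⌊a * n⌋₊ : ℝ) * (t / n)) atTop (𝓝 (a * t)) := by
  refine (((tendsto_nat_floor_mul_div_atTop ha).comp
    tendsto_natCast_atTop_atTop).mul_const t).congr fun n => ?_
  simp only [Function.comp_apply]
  ring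

/-! ### Semigroups, generators and Chernoff's formula -/

namespace ContractionSemigroup

variable {𝕜 X : Type*} [RCLike 𝕜] [NormedAddCommGroup X] [NormedSpace 𝕜 X]

theorem graph_generator (U : ContractionSemigroup 𝕜 X) : U.generator.graph = derivGraph U := by
  ext ⟨u, y⟩
  rw [LinearPMap.mem_graph_iff]
  constructor
  · rintro ⟨x, rfl, rfl⟩
    exact U.hasGeneratorAt_generator x
  · intro h
    exact ⟨⟨u, y, h⟩, rfl, (U.hasGeneratorAt_generator _).unique h⟩

theorem pow_apply (U : ContractionSemigroup 𝕜 X) (t : ℝ≥0) (n : ℕ) : U t ^ n = U (n * t) := by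
  induction n with
  | zero => simp [U.map_zero]
  | succ n ih => rw [pow_succ, ih, ← U.map_add, Nat.cast_succ, add_mul, one_mul]

theorem apply_comm (U : ContractionSemigroup 𝕜 X) (s t : ℝ≥0) (x : X) :
    U s (U t x) = U t (U s x) := by
  have h : U s * U t = U t * U s := by rw [← U.map_add, add_comm, U.map_add]
  exact congr($h x)

theorem norm_apply_le (U : ContractionSemigroup 𝕜 X) (t : ℝ≥0) (x : X) : ‖U t x‖ ≤ ‖x‖ :=
  ContinuousLinearMap.norm_apply_le_of_norm_le_one (U.norm_le_one t) x

theorem map_mem_derivGraph (U : ContractionSemigroup 𝕜 X) (s : ℝ≥0) {p : X × X}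
    (hp : p ∈ derivGraph U) : (U s p.1, U s p.2) ∈ derivGraph U := by
  refine (((U s).continuous.tendsto _).comp (mem_derivGraph.1 hp)).congr fun h => ?_
  simp only [Function.comp_apply, map_smul, map_sub]
  rw [U.apply_comm]

theorem tendsto_apply_nhdsGT_zero (U : ContractionSemigroup 𝕜 X) (x : X) :
    Tendsto (fun h => U h x) (𝓝[>] 0) (𝓝 x) := by
  have h := (U.continuous_apply x).tendsto 0
  rw [U.map_zero] at h
  exact h.mono_left nhdsWithin_le_nhds

/-- The domain of the generator is dense. -/
theorem mem_closure_fst_derivGraph [CompleteSpace X] (U : ContractionSemigroup 𝕜 X) (x : X) :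
    x ∈ closure (Prod.fst '' (derivGraph U : Set (X × X))) := by
  let _ : NormedSpace ℝ X := NormedSpace.restrictScalars ℝ 𝕜 X
  have hsmul : ∀ (r : ℝ) (y : X), r • y = (r : 𝕜) • y := fun r y => by
    rw [RCLike.ofReal_alg, smul_assoc, one_smul]
  let φ : ℝ → X := fun r => U r.toNNReal x
  have hφ : Continuous φ := (U.continuous_apply x).comp continuous_real_toNNReal
  have hφ0 : φ 0 = x := by simp [φ, U.map_zero]
  -- The averages `Φ δ / δ` tend to `x` and lie in the domain: shifting the integral differentiates
  -- `Φ δ` along the semigroup.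
  let Φ : ℝ → X := fun s => ∫ r in (0 : ℝ)..s, φ r
  have hΦ : ∀ s, HasDerivAt Φ (φ s) s := fun s => hφ.integral_hasStrictDerivAt 0 s |>.hasDerivAt
  have hΦ0 : Φ 0 = 0 := by simp [Φ]
  have hshift : ∀ (δ : ℝ), 0 ≤ δ → ∀ h : ℝ≥0, U h (Φ δ) = Φ (δ + h) - Φ h := by
    intro δ hδ h
    have h1 : U h (Φ δ) = ∫ r in (0 : ℝ)..δ, U h (φ r) :=
      ((U h).intervalIntegral_comp_comm (hφ.intervalIntegrable _ _)).symm
    have h2 : ∫ r in (0 : ℝ)..δ, U h (φ r) = ∫ r in (0 : ℝ)..δ, φ (r + h) := by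
      refine intervalIntegral.integral_congr fun r hr => ?_
      rw [Set.uIcc_of_le hδ] at hr
      simp only [φ]
      rw [Real.toNNReal_add hr.1 h.coe_nonneg, Real.toNNReal_coe, add_comm, U.map_add]
      rfl
    rw [h1, h2, intervalIntegral.integral_comp_add_right, zero_add,
      intervalIntegral.integral_interval_sub_left] <;> exact hφ.intervalIntegrable _ _
  have hmem : ∀ δ : ℝ, 0 ≤ δ → (Φ δ, x - φ δ) ∈ derivGraph U := by
    intro δ hδ
    have hd : ∀ s, Tendsto (fun h : ℝ≥0 => ((h : ℝ) : 𝕜)⁻¹ • (Φ (s + h) - Φ s)) (𝓝[>] 0)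
        (𝓝 (φ s)) := by
      intro s
      have h1 := (hasDerivAt_iff_tendsto_slope_zero.1 (hΦ s))
      have h2 : Tendsto (fun h : ℝ≥0 => (h : ℝ)) (𝓝[>] 0) (𝓝[≠] 0) := by
        refine tendsto_nhdsWithin_iff.2 ⟨?_, ?_⟩
        · exact (NNReal.continuous_coe.tendsto 0).mono_left nhdsWithin_le_nhds
        · filter_upwards [self_mem_nhdsWithin] with h hh
          have : (0 : ℝ≥0) < h := hh
          simpa using this.ne'
      refine (h1.comp h2).congr fun h => ?_
      simp [hsmul]
    have h1 := (hd 0).sub (hd δ)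
    rw [hφ0] at h1
    refine h1.congr fun h => ?_
    rw [hshift δ hδ, ← smul_sub, hΦ0, zero_add]
    congr 1
    abel
  have hlim : Tendsto (fun δ : ℝ => (δ : 𝕜)⁻¹ • Φ δ) (𝓝[>] 0) (𝓝 x) := by
    have h1 := (hasDerivAt_iff_tendsto_slope_zero.1 (hΦ 0)).mono_left
      (nhdsWithin_mono _ fun y (hy : (0 : ℝ) < y) => hy.ne')
    rw [hφ0] at h1
    refine h1.congr fun δ => ?_
    simp [hsmul, hΦ0]
  refine mem_closure_of_tendsto hlim ?_
  filter_upwards [self_mem_nhdsWithin] with δ hδ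
  exact ⟨_, (derivGraph U).smul_mem ((δ : 𝕜)⁻¹) (hmem δ (le_of_lt hδ)), rfl⟩

/-- Chernoff's product formula on the domain of the generator. -/
theorem tendsto_pow_apply_of_mem_derivGraph (S : ContractionSemigroup 𝕜 X)
    {F : ℝ≥0 → X →L[𝕜] X} (hF : ∀ h, ‖F h‖ ≤ 1)
    (hS : derivGraph S ≤ (derivGraph F).topologicalClosure) {t : ℝ≥0} (ht : 0 < t) {p : X × X}
    (hp : p ∈ derivGraph S) :
    Tendsto (fun n : ℕ => (F (t / n) ^ n) p.1) atTop (𝓝 (S t p.1)) := by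
  have hh := NNReal.tendsto_div_natCast_nhdsGT_zero ht
  -- The two-point bound between `p` and its image under `S δ`. By contractivity of `S s` it serves
  -- every block, wherever the block starts.
  let c : ℝ≥0 → ℝ := fun δ =>
    ‖S δ p.1 - p.1 + ((δ : ℝ) : 𝕜) • p.2‖ + ‖((δ : ℝ) : 𝕜) • (S δ p.2 - p.2)‖
  have hblock : ∀ N : ℕ, 0 < N → ∀ i : ℕ, ∀ ε > 0, ∀ᶠ n : ℕ in atTop,
      ‖(F (t / n) ^ ⌊(i / N : ℝ) * n⌋₊) p.1 - S (i * (t / N)) p.1‖ < i * c (t / N) + ε := by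
    intro N hN i
    have hN' : (0 : ℝ) < N := by exact_mod_cast hN
    induction i with
    | zero =>
      intro ε hε
      exact Eventually.of_forall fun n => by simpa [S.map_zero] using hε
    | succ i ih =>
      intro ε hε
      set s : ℝ≥0 := i * (t / N) with hs
      set δ : ℝ≥0 := t / N with hδ
      have hle : ∀ n : ℕ, ⌊(i / N : ℝ) * n⌋₊ ≤ ⌊((i + 1 : ℕ) / N : ℝ) * n⌋₊ := fun n => by
        apply Nat.floor_mono
        gcongr
        simp
      -- Block `i` has a difference of floors as its number of steps of length `t / n`, so its
      -- duration is `δ` only in the limit.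
      have hk : Tendsto (fun n : ℕ => ((⌊((i + 1 : ℕ) / N : ℝ) * n⌋₊ - ⌊(i / N : ℝ) * n⌋₊ : ℕ) : ℝ)
          * (t / n : ℝ≥0)) atTop (𝓝 (δ : ℝ)) := by
        have h1 := (tendsto_natFloor_mul_mul_div (a := (i + 1 : ℕ) / N) (by positivity) t).sub
          (tendsto_natFloor_mul_mul_div (a := i / N) (by positivity) t)
        have h2 : ((i + 1 : ℕ) / N : ℝ) * t - i / N * t = (δ : ℝ) := by
          rw [hδ]; push_cast; ring
        rw [h2] at h1
        refine h1.congr fun n => ?_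
        rw [Nat.cast_sub (hle n)]
        push_cast
        ring
      have h1 := S.map_mem_derivGraph s hp
      have h2 := S.map_mem_derivGraph (s + δ) hp
      have hc : ‖S (s + δ) p.1 - S s p.1 + ((δ : ℝ) : 𝕜) • S s p.2‖ +
          ‖((δ : ℝ) : 𝕜) • (S (s + δ) p.2 - S s p.2)‖ ≤ c δ := by
        have e1 : S (s + δ) p.1 - S s p.1 + ((δ : ℝ) : 𝕜) • S s p.2 =
            S s (S δ p.1 - p.1 + ((δ : ℝ) : 𝕜) • p.2) := by
          rw [S.map_add]; simp
        have e2 : ((δ : ℝ) : 𝕜) • (S (s + δ) p.2 - S s p.2) =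
            S s (((δ : ℝ) : 𝕜) • (S δ p.2 - p.2)) := by
          rw [S.map_add]; simp
        rw [e1, e2]
        exact add_le_add (S.norm_apply_le _ _) (S.norm_apply_le _ _)
      filter_upwards [ih (ε / 2) (half_pos hε), eventually_norm_pow_apply_sub_lt hF hh hk
        (hS h1) (hS h2) (c := c δ + ε / 2) (hc.trans_lt (by linarith))] with n hn1 hn2
      have hpow : (F (t / n) ^ ⌊((i + 1 : ℕ) / N : ℝ) * n⌋₊) p.1 =
          (F (t / n) ^ (⌊((i + 1 : ℕ) / N : ℝ) * n⌋₊ - ⌊(i / N : ℝ) * n⌋₊))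
            ((F (t / n) ^ ⌊(i / N : ℝ) * n⌋₊) p.1) := by
        conv_lhs => rw [← Nat.sub_add_cancel (hle n), pow_add]
        rfl
      have hsδ : ((i + 1 : ℕ) : ℝ≥0) * δ = s + δ := by rw [hs]; push_cast; ring
      rw [hsδ, hpow, ← sub_add_sub_cancel _ ((F (t / n) ^
        (⌊((i + 1 : ℕ) / N : ℝ) * n⌋₊ - ⌊(i / N : ℝ) * n⌋₊)) (S s p.1)), ← map_sub]
      refine (norm_add_le _ _).trans_lt ?_
      have h3 := ContinuousLinearMap.norm_pow_apply_le_of_norm_le_one (hF (t / n))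
        (⌊((i + 1 : ℕ) / N : ℝ) * n⌋₊ - ⌊(i / N : ℝ) * n⌋₊)
        ((F (t / n) ^ ⌊(i / N : ℝ) * n⌋₊) p.1 - S s p.1)
      have hi : ((i + 1 : ℕ) : ℝ) * c δ = i * c δ + c δ := by push_cast; ring
      linarith
  -- `c δ = o(δ)`: the first term by differentiability at `p.1`, the second by strong continuity at
  -- `p.2`.
  have hcδ : Tendsto (fun N : ℕ => N * c (t / N)) atTop (𝓝 0) := by
    have hk : Tendsto (fun n : ℕ => (n : ℝ) * (t / n : ℝ≥0)) atTop (𝓝 (t : ℝ)) := by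
      refine tendsto_const_nhds.congr' ?_
      filter_upwards [eventually_gt_atTop 0] with n hn
      have : (n : ℝ) ≠ 0 := by exact_mod_cast hn.ne'
      push_cast
      field_simp
    have hk' : Tendsto (fun n : ℕ => (n : 𝕜) * ((t / n : ℝ≥0) : ℝ)) atTop (𝓝 ((t : ℝ) : 𝕜)) := by
      refine ((RCLike.continuous_ofReal (K := 𝕜)).tendsto (t : ℝ) |>.comp hk).congr fun n => ?_
      simp only [Function.comp_apply]
      rw [RCLike.ofReal_mul, RCLike.ofReal_natCast]
    have h1 := tendsto_natCast_smul_of_mem_derivGraph hh hk hp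
    have h2 := ((hk'.smul_const p.2).sub h1).norm
    have h3 := (hk'.smul (((S.tendsto_apply_nhdsGT_zero p.2).comp hh).sub_const p.2)).norm
    have h4 := h2.add h3
    rw [sub_self, sub_self, smul_zero, norm_zero, add_zero] at h4
    refine h4.congr fun n => ?_
    simp only [c, Function.comp_apply]
    rw [mul_smul, mul_smul, ← smul_sub, norm_smul, norm_smul (n : 𝕜), RCLike.norm_natCast, mul_add]
    congr 3
    abel
  rw [Metric.tendsto_atTop']
  intro ε hε
  obtain ⟨N, hN, hN0⟩ :=
    ((hcδ.eventually_lt_const (half_pos hε)).and (eventually_gt_atTop 0)).exists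
  obtain ⟨n₀, hn₀⟩ := eventually_atTop.1 (hblock N hN0 N (ε / 2) (half_pos hε))
  refine ⟨n₀, fun n hn => ?_⟩
  have h1 := hn₀ n hn.le
  have hN1 : (N : ℝ) ≠ 0 := by exact_mod_cast hN0.ne'
  have hN2 : (N : ℝ≥0) ≠ 0 := by exact_mod_cast hN0.ne'
  rw [div_self hN1, one_mul, Nat.floor_natCast, mul_div_cancel₀ t hN2] at h1
  rw [dist_eq_norm]
  linarith

/-- **Chernoff's product formula.** -/
theorem tendsto_pow_apply [CompleteSpace X] (S : ContractionSemigroup 𝕜 X)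
    {F : ℝ≥0 → X →L[𝕜] X} (hF : ∀ h, ‖F h‖ ≤ 1)
    (hS : derivGraph S ≤ (derivGraph F).topologicalClosure) {t : ℝ≥0} (ht : 0 < t) (x : X) :
    Tendsto (fun n : ℕ => (F (t / n) ^ n) x) atTop (𝓝 (S t x)) := by
  rw [Metric.tendsto_nhds]
  intro ε hε
  obtain ⟨_, ⟨p, hp, rfl⟩, hxp⟩ :=
    Metric.mem_closure_iff.1 (S.mem_closure_fst_derivGraph x) (ε / 3) (by positivity)
  filter_upwards [Metric.tendsto_nhds.1 (S.tendsto_pow_apply_of_mem_derivGraph hF hS ht hp)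
    (ε / 3) (by positivity)] with n hn
  rw [dist_eq_norm] at hn hxp ⊢
  have hsplit : (F (t / n) ^ n) x - S t x =
      (F (t / n) ^ n) (x - p.1) + ((F (t / n) ^ n) p.1 - S t p.1) - S t (x - p.1) := by
    simp only [map_sub]
    abel
  rw [hsplit]
  have h1 := ContinuousLinearMap.norm_pow_apply_le_of_norm_le_one (hF (t / n)) n (x - p.1)
  have h2 := S.norm_apply_le t (x - p.1)
  refine (norm_sub_le _ _).trans_lt ?_
  have h3 := norm_add_le ((F (t / n) ^ n) (x - p.1)) ((F (t / n) ^ n) p.1 - S t p.1)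
  linarith

/-- If the generator of `S` is contained in the closure of the derivative of `F` at `0`, then the
two are equal. -/
theorem topologicalClosure_derivGraph_le [CompleteSpace X] (S : ContractionSemigroup 𝕜 X)
    {F : ℝ≥0 → X →L[𝕜] X} (hF : ∀ h, ‖F h‖ ≤ 1)
    (hS : derivGraph S ≤ (derivGraph F).topologicalClosure) :
    (derivGraph F).topologicalClosure ≤ derivGraph S := by
  intro p hp
  -- The target is `q = p - δ e`. The ideal direction `p.2` need not lie in the domain, so a nearby
  -- `e.1` from the dense domain replaces it; this keeps `q` in the closed graph.
  have hbound : ∀ e ∈ derivGraph S, ∀ δ : ℝ≥0, 0 < δ →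
      ‖S δ p.1 - (p.1 - ((δ : ℝ) : 𝕜) • e.1)‖ ≤ δ * ‖p.2 - e.1‖ + δ * (δ * ‖e.2‖) := by
    intro e he δ hδ
    have hh := NNReal.tendsto_div_natCast_nhdsGT_zero hδ
    have hk : Tendsto (fun n : ℕ => (n : ℝ) * (δ / n : ℝ≥0)) atTop (𝓝 (δ : ℝ)) := by
      refine tendsto_const_nhds.congr' ?_
      filter_upwards [eventually_gt_atTop 0] with n hn
      have : (n : ℝ) ≠ 0 := by exact_mod_cast hn.ne'
      push_cast
      field_simp
    have hq := sub_mem hp (Submodule.smul_mem _ ((δ : ℝ) : 𝕜) (hS he))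
    refine le_of_forall_gt_imp_ge_of_dense fun c hc => ?_
    have hlim := ((S.tendsto_pow_apply hF hS hδ p.1).sub_const
      (p.1 - ((δ : ℝ) : 𝕜) • e.1)).norm
    refine le_of_tendsto hlim ?_
    refine (eventually_norm_pow_apply_sub_lt hF hh hk hp hq (c := c) ?_).mono fun n hn => hn.le
    refine lt_of_le_of_lt (le_of_eq ?_) hc
    have hδn : ‖((δ : ℝ) : 𝕜)‖ = δ := by
      rw [RCLike.norm_ofReal, NNReal.abs_eq]
    have e1 : (p - ((δ : ℝ) : 𝕜) • e).1 - p.1 + ((δ : ℝ) : 𝕜) • p.2 =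
        ((δ : ℝ) : 𝕜) • (p.2 - e.1) := by
      simp only [Prod.fst_sub, Prod.smul_fst, smul_sub]; abel
    have e2 : (p - ((δ : ℝ) : 𝕜) • e).2 - p.2 = - (((δ : ℝ) : 𝕜) • e.2) := by
      simp only [Prod.snd_sub, Prod.smul_snd]; abel
    rw [e1, e2, norm_smul, norm_smul, norm_neg, norm_smul, hδn]
  rw [mem_derivGraph, Metric.tendsto_nhds]
  intro ε hε
  obtain ⟨_, ⟨e, he, rfl⟩, hpe⟩ :=
    Metric.mem_closure_iff.1 (S.mem_closure_fst_derivGraph p.2) (ε / 3) (by positivity)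
  rw [dist_eq_norm] at hpe
  have hsmall : ∀ᶠ δ : ℝ≥0 in 𝓝[>] 0, (δ : ℝ) * ‖e.2‖ < ε / 3 := by
    have h1 : Tendsto (fun δ : ℝ≥0 => (δ : ℝ) * ‖e.2‖) (𝓝[>] 0) (𝓝 0) := by
      have h2 : Continuous fun δ : ℝ≥0 => (δ : ℝ) * ‖e.2‖ := by fun_prop
      exact (h2.tendsto' 0 0 (by simp)).mono_left nhdsWithin_le_nhds
    exact h1.eventually_lt_const (by positivity)
  filter_upwards [hsmall, self_mem_nhdsWithin] with δ hδ1 hδ2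
  have hδ0 : (0 : ℝ) < δ := hδ2
  have hδk : ((δ : ℝ) : 𝕜) ≠ 0 := by exact_mod_cast hδ0.ne'
  have h1 := hbound e he δ hδ2
  have hsplit : ((δ : ℝ) : 𝕜)⁻¹ • (p.1 - S δ p.1) - p.2 =
      -(((δ : ℝ) : 𝕜)⁻¹ • (S δ p.1 - (p.1 - ((δ : ℝ) : 𝕜) • e.1))) - (p.2 - e.1) := by
    simp only [smul_sub, inv_smul_smul₀ hδk]
    abel
  rw [dist_eq_norm, hsplit]
  refine (norm_sub_le _ _).trans_lt ?_
  rw [norm_neg, norm_smul, norm_inv, RCLike.norm_ofReal, abs_of_pos hδ0]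
  have h2 : (δ : ℝ)⁻¹ * ‖S δ p.1 - (p.1 - ((δ : ℝ) : 𝕜) • e.1)‖ ≤ ‖p.2 - e.1‖ + δ * ‖e.2‖ := by
    rw [inv_mul_le_iff₀ hδ0, mul_add]
    exact h1
  linarith

/-- With `F = U` the hypothesis of `topologicalClosure_derivGraph_le` is trivial, and its conclusion
is closedness. -/
theorem isClosed_generator [CompleteSpace X] (U : ContractionSemigroup 𝕜 X) :
    U.generator.IsClosed := by
  rw [LinearPMap.IsClosed, graph_generator]
  exact isClosed_of_closure_subset
    (U.topologicalClosure_derivGraph_le U.norm_le_one (Submodule.le_topologicalClosure _))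

/-- Split `u - U V u = (u - U u) + U (u - V u)`; contractivity and strong continuity of `U` handle
the second term. -/
theorem add_mem_derivGraph_mul (U V : ContractionSemigroup 𝕜 X) {u y z : X}
    (hy : U.HasGeneratorAt u y) (hz : V.HasGeneratorAt u z) :
    (u, y + z) ∈ derivGraph fun h => U h * V h := by
  have h1 : Tendsto (fun h : ℝ≥0 => U h ((((h : ℝ) : 𝕜)⁻¹) • (u - V h u))) (𝓝[>] 0) (𝓝 z) := by
    have h2 : Tendsto (fun h : ℝ≥0 => U h ((((h : ℝ) : 𝕜)⁻¹) • (u - V h u) - z)) (𝓝[>] 0)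
        (𝓝 0) := by
      refine squeeze_zero_norm (fun h => U.norm_apply_le h _) ?_
      simpa using (Tendsto.sub_const hz z).norm
    have h3 := h2.add (U.tendsto_apply_nhdsGT_zero z)
    rw [zero_add] at h3
    refine h3.congr fun h => ?_
    rw [← _root_.map_add, sub_add_cancel]
  refine (Tendsto.add hy h1).congr fun h => ?_
  rw [map_smul, ← smul_add, map_sub, sub_add_sub_cancel]
  rfl

end ContractionSemigroup

/-! ### The closure of the sum and the product formula -/

theorem LinearPMap.IsClosed.closure_eq {R E F : Type*} [CommRing R] [AddCommGroup E]
    [AddCommGroup F] [Module R E] [Module R F] [TopologicalSpace E] [TopologicalSpace F]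
    [ContinuousAdd E] [ContinuousAdd F] [TopologicalSpace R] [ContinuousSMul R E]
    [ContinuousSMul R F] {f : E →ₗ.[R] F} (hf : f.IsClosed) : f.closure = f := by
  refine LinearPMap.eq_of_eq_graph ?_
  rw [← hf.isClosable.graph_closure_eq_closure_graph]
  exact IsClosed.submodule_topologicalClosure_eq hf

/-- **Lie–Trotter product formula.** -/
theorem proposition2 {𝕜 X : Type*} [RCLike 𝕜] [NormedAddCommGroup X] [NormedSpace 𝕜 X]
    [CompleteSpace X] (UA UB UC : ContractionSemigroup 𝕜 X) (A B C : X →ₗ.[𝕜] X)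
    (hA : A = UA.generator) (hB : B = UB.generator) (hC : C = UC.generator)
    (D : Submodule 𝕜 X) (hD : C.HasCore D) (hDA : D ≤ A.domain) (hDB : D ≤ B.domain)
    (hsum : ∀ (u : X) (hu : u ∈ D),
      C ⟨u, hD.le_domain hu⟩ = A ⟨u, hDA hu⟩ + B ⟨u, hDB hu⟩) :
    ((A + B).IsClosable ∧ (A + B).closure = C) ∧
      ∀ (t : ℝ≥0) (x : X),
        Tendsto (fun n : ℕ => ((UA (t / n) * UB (t / n)) ^ n) x) atTop (𝓝 (UC t x)) := by
  subst hA hB hC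
  set F : ℝ≥0 → X →L[𝕜] X := fun h => UA h * UB h with hFdef
  have hF : ∀ h, ‖F h‖ ≤ 1 := fun h =>
    (norm_mul_le _ _).trans (mul_le_one₀ (UA.norm_le_one h) (norm_nonneg _) (UB.norm_le_one h))
  have hsumF : (UA.generator + UB.generator).graph ≤ derivGraph F := by
    rintro ⟨u, w⟩ h
    obtain ⟨x, rfl, rfl⟩ := (LinearPMap.mem_graph_iff _).1 h
    exact UA.add_mem_derivGraph_mul UB (UA.hasGeneratorAt_generator ⟨x, x.2.1⟩)
      (UB.hasGeneratorAt_generator ⟨x, x.2.2⟩)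
  have hle : UC.generator.domRestrict D ≤ UA.generator + UB.generator := by
    refine ⟨fun x hx => ⟨hDA hx.1, hDB hx.1⟩, ?_⟩
    rintro ⟨x, hx⟩ ⟨y, hy⟩ rfl
    exact (LinearPMap.domRestrict_apply (y := ⟨x, hD.le_domain hx.1⟩) rfl).trans (hsum x hx.1)
  have hCclosed := UC.isClosed_generator
  have hrestr : (UC.generator.domRestrict D).IsClosable :=
    hCclosed.isClosable.leIsClosable LinearPMap.domRestrict_le
  -- The only use of density in the graph norm: `C` is the closure of its restriction to `D`, which
  -- `A + B` extends.
  have hS : derivGraph UC ≤ (derivGraph F).topologicalClosure := by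
    rw [← UC.graph_generator]
    conv_lhs => rw [← hD.closure_eq, ← hrestr.graph_closure_eq_closure_graph]
    exact Submodule.topologicalClosure_mono ((LinearPMap.le_graph_of_le hle).trans hsumF)
  -- Agreement is assumed only on `D`; on the rest of the domain of `A + B` it comes from the
  -- reverse inclusion.
  have hle' : UA.generator + UB.generator ≤ UC.generator := by
    refine LinearPMap.le_of_le_graph (hsumF.trans ?_)
    rw [UC.graph_generator]
    exact (Submodule.le_topologicalClosure _).trans (UC.topologicalClosure_derivGraph_le hF hS)
  have hclosable := hCclosed.isClosable.leIsClosable hle'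
  refine ⟨⟨hclosable, le_antisymm ?_ ?_⟩, fun t x => ?_⟩
  · exact (hCclosed.isClosable.closure_mono hle').trans_eq hCclosed.closure_eq
  · exact hD.closure_eq.symm.trans_le (hclosable.closure_mono hle)
  · rcases eq_or_lt_of_le (zero_le : 0 ≤ t) with rfl | ht
    · simp [UA.map_zero, UB.map_zero, UC.map_zero]
    · exact UC.tendsto_pow_apply hF hS ht x
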